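/- Let $K$ be a number field. Put $i=\sqrt{-1}$, and for $m\ge 1$ let $\zeta_m$ denote a primitive $m$-th root of unity. For an odd prime $p$ let $\epsilon_p=\gcd\{e_{\mathfrak p/p} : \mathfrak p \text{ a prime of } K,\ \mathfrak p\mid p\}$ be the greatest common divisor of the ramification indices of the primes of $K$ above $p$, and call $p$ distinguished if $p-1\mid \epsilon_p$. Let $\epsilon_2=\gcd\{e_{\mathfrak p/(1+i)} : \mathfrak p \text{ a prime of } K(i),\ \mathfrak p\mid 1+i\}$ be the greatest common divisor of the ramification indices, over the prime $(1+i)$ of $\mathbb Q(i)$, of the primes of $K(i)$ above $1+i$. With $\nu_p$ the $p$-adic valuation, put $$\lambda_p=\begin{cases}\nu_p(\epsilon_p)+1,& p\ge 3 \text{ distinguished},\\ \nu_2(\epsilon_2)+3,& p=2,\\ 0,& \text{for all other primes } p.\end{cases}$$ Theorem 1.1 (Chevalley, Bass). There exists a positive integer $\Lambda$, depending only on $K$, such that for every integer $n\ge 1$ the following holds: if $\alpha\in K$ is a $(\Lambda n)$-th power in $K(\zeta_{\Lambda n})$, then $\alpha$ is an $n$-th power in $K$; that is, $K(\zeta_{\Lambda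 n})^{\Lambda n}\cap K\subset K^n$. Moreover, there are only finitely many distinguished primes, and one may take $$\Lambda=4^{\lambda_2}\prod_{p\ge 3}p^{\lambda_p},$$ where the product is over all odd primes $p$ (only the distinguished ones contribute). -/

import Mathlib

open scoped NumberField

noncomputable section

namespace ChevalleyBass

variable (K : Type*) [Field K] [NumberField K]

/-- The field `K(i) = K(ζ₄)`. -/
abbrev AdjoinI : Type _ := CyclotomicField 4 K

/-- The square root of `-1` in `K(i)`: the chosen primitive fourth root of unity `ζ₄`,
as an algebraic integer. -/
def imag : 𝓞 (AdjoinI K) :=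
  (IsCyclotomicExtension.zeta_spec 4 K (AdjoinI K)).toInteger

theorem imag_mul_imag : imag K * imag K = ((-1 : ℤ) : 𝓞 (AdjoinI K)) := by
  have h : IsPrimitiveRoot (imag K) 4 :=
    (IsCyclotomicExtension.zeta_spec 4 K (AdjoinI K)).toInteger_isPrimitiveRoot
  have h2 : IsPrimitiveRoot (imag K ^ 2) 2 := h.pow (by norm_num) (by norm_num)
  have h3 := h2.eq_neg_one_of_two_right
  rw [← pow_two, h3]
  norm_num

/-- The extension of rings of integers `ℤ[i] ⊆ 𝓞_{K(i)}`. -/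
instance algebraGaussianInt : Algebra GaussianInt (𝓞 (AdjoinI K)) :=
  (Zsqrtd.lift ⟨imag K, imag_mul_imag K⟩).toAlgebra

/-- For an odd prime `p`: the greatest common divisor `ε_p` of the ramification indices
`e(𝔭/p)` over all primes `𝔭` of `K` above `p`. -/
def epsilon (p : ℕ) : ℕ :=
  (IsDedekindDomain.primesOverFinset (Ideal.span {(p : ℤ)}) (𝓞 K)).gcd
    fun 𝔭 => 𝔭.ramificationIdx ℤ

/-- The greatest common divisor `ε₂` of the ramification indices `e(𝔭/(1+i))` over all primes
`𝔭` of `K(i)` above the prime `1 + i` of `ℤ[i]`. -/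
def epsilonTwo : ℕ :=
  (IsDedekindDomain.primesOverFinset (Ideal.span {(⟨1, 1⟩ : GaussianInt)})
    (𝓞 (AdjoinI K))).gcd fun 𝔭 => 𝔭.ramificationIdx GaussianInt

/-- An odd prime `p` is distinguished if `p - 1` divides `ε_p`. -/
def Distinguished (p : ℕ) : Prop :=
  p.Prime ∧ 3 ≤ p ∧ p - 1 ∣ epsilon K p

open scoped Classical in
/-- The exponent `λ_p` attached to a prime `p`. -/
def lam (p : ℕ) : ℕ :=
  if p = 2 then padicValNat 2 (epsilonTwo K) + 3
  else if Distinguished K p then padicValNat p (epsilon K p) + 1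
  else 0

/-- The integer `4 ^ λ₂ * ∏_{p ≥ 3} p ^ λ_p`. -/
def bassConstant : ℕ :=
  4 ^ lam K 2 * ∏ᶠ (p : ℕ) (_ : p.Prime ∧ 3 ≤ p), p ^ lam K p

end ChevalleyBass

end

namespace ChevalleyBass

/-! ### Lifting the exponent for `c ^ p ^ j - 1`. -/

section LiftingTheExponent

variable {p : ℕ} {c : ℤ} {s : ℕ}

/-! Bézout exponents reduce the claim to prime powers `p ^ k ∣ n`. Write `Λn = p ^ r * m` with `p ∤
m`, so `λ_p + k ≤ r`, and let `M` be `K`, or `K(i)` if `p = 2`. Above `p`, `M(ζ_m)/M` is unramified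
while `ℚ(ζ_{p^j})` is totally ramified; `λ_p` is chosen so that `M(ζ_m)` has no primitive `p ^ (λ_p
+ 1)`-th root of unity (`dvd_ramificationIdx_of_isPrimitiveRoot`).

Hence some `σ` fixing `M(ζ_m)` sends `η`, of order `p ^ r`, to `η ^ c` with `s = ν_p(c - 1) ≤ λ_p`
(`exists_prime_pow_eq`). A `p ^ r`-th root `β` of `α` satisfies `σ β = η ^ a * β`. Lifting the
exponent gives `p ^ s ∣ a`, so a power of `η` corrects `β` to a `σ`-fixed root. As the Galois group
over `K` is abelian, the `p ^ s`-th power of that root lies in `K` (`exists_pow_eq_of_cyclotomic`).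
So `α` is a `p ^ (r - s)`-th power, and `k ≤ r - s`. -/

theorem emultiplicity_pow_prime_pow_sub_one (hp : p.Prime) (hs : emultiplicity (p : ℤ) (c - 1) = s)
    (hs1 : 1 ≤ s) (hs2 : p = 2 → 2 ≤ s) (j : ℕ) :
    emultiplicity (p : ℤ) (c ^ p ^ j - 1) = s + j := by
  have hdvd : (p : ℤ) ^ s ∣ c - 1 := pow_dvd_of_le_emultiplicity hs.ge
  have hpc : (p : ℤ) ∣ c - 1 := (dvd_pow_self _ (by omega)).trans hdvd
  have hc : ¬ (p : ℤ) ∣ c := fun h => by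
    have : (p : ℤ) ∣ 1 := by simpa using dvd_sub h hpc
    exact (Nat.prime_iff_prime_int.mp hp).not_dvd_one this
  have hpj : emultiplicity (p : ℤ) ((p : ℤ) ^ j) = j :=
    emultiplicity_pow_self_of_prime (Nat.prime_iff_prime_int.mp hp) j
  rcases hp.eq_two_or_odd' with rfl | hodd
  · have h4 : (4 : ℤ) ∣ c - 1 := (pow_dvd_pow (2 : ℤ) (hs2 rfl)).trans hdvd
    have h := Int.two_pow_sub_pow' (x := c) (y := 1) (2 ^ j) h4 (by exact_mod_cast hc)
    rw [one_pow] at h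
    push_cast at h hs hpj ⊢
    rw [h, hs, hpj]
  · have h := Int.emultiplicity_pow_sub_pow hp hodd (x := c) (y := 1) hpc hc (p ^ j)
    rw [one_pow, hs, ← Int.natCast_emultiplicity] at h
    push_cast at h
    rw [h, hpj]

/-- Multiplying by `c - 1` turns the sum into `c ^ p ^ j - 1`, of valuation exactly `s + j`;
cancelling leaves `s` for `a`. -/
theorem prime_pow_dvd_of_dvd_mul_geom_sum (hp : p.Prime)
    (hs : emultiplicity (p : ℤ) (c - 1) = s) (hs1 : 1 ≤ s) (hs2 : p = 2 → 2 ≤ s) {j : ℕ} {a : ℤ}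
    (h : (p : ℤ) ^ (s + j) ∣ a * ∑ i ∈ Finset.range (p ^ j), c ^ i) : (p : ℤ) ^ s ∣ a := by
  have hpp := Nat.prime_iff_prime_int.mp hp
  have h1 : (p : ℤ) ^ (s + j + s) ∣ a * (c ^ p ^ j - 1) := by
    rw [← geom_sum_mul, ← mul_assoc, pow_add]
    exact mul_dvd_mul h (pow_dvd_of_le_emultiplicity hs.ge)
  have h2 := le_emultiplicity_of_pow_dvd h1
  rw [emultiplicity_mul hpp, emultiplicity_pow_prime_pow_sub_one hp hs hs1 hs2] at h2
  apply pow_dvd_of_le_emultiplicity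
  have h3 : ((s + j : ℕ) : ℕ∞) + s ≤ ((s + j : ℕ) : ℕ∞) + emultiplicity (p : ℤ) a := by
    push_cast at h2 ⊢
    rwa [add_comm (emultiplicity (p : ℤ) a)] at h2
  exact (ENat.add_le_add_iff_left (ENat.natCast_ne_top _)).mp h3

end LiftingTheExponent

/-! ### Kummer theory inside an abelian extension. -/

section Kummer

variable {K L : Type*} [Field K] [Field L] [Algebra K L] {p r s : ℕ} {c : ℤ} {η : L}

theorem exists_map_zpow_mul_eq (hp : p.Prime) (hη : IsPrimitiveRoot η (p ^ r))
    (hs : emultiplicity (p : ℤ) (c - 1) = s) (hsr : s ≤ r) (σ : Gal(L/K)) (hσ : σ η = η ^ c)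
    {β : L} {a : ℤ} (hβ : σ β = η ^ a * β) (ha : (p : ℤ) ^ s ∣ a) :
    ∃ t : ℤ, σ (η ^ t * β) = η ^ t * β := by
  have hη0 : η ≠ 0 := hη.ne_zero (pow_ne_zero _ hp.ne_zero)
  obtain ⟨⟨u, hu⟩, hn⟩ := emultiplicity_eq_coe.mp hs
  obtain ⟨a', rfl⟩ := ha
  have hpu : ¬ (p : ℤ) ∣ u := fun ⟨w, hw⟩ => hn ⟨w, by rw [hu, hw]; ring⟩
  obtain ⟨x, y, hxy⟩ : IsCoprime u ((p : ℤ) ^ (r - s)) :=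
    (((Nat.prime_iff_prime_int.mp hp).irreducible.coprime_iff_not_dvd).mpr hpu).symm.pow_right
  have hr : (p : ℤ) ^ r = p ^ s * p ^ (r - s) := by rw [← pow_add, Nat.add_sub_cancel' hsr]
  -- The exponent `t` must solve `(c - 1) * t + p ^ s * a' ≡ 0` modulo `p ^ r`; here `c - 1 = p ^ s
  -- * u` and `x` inverts `u` modulo `p ^ (r - s)`.
  refine ⟨-(a' * x), ?_⟩
  have h1 : η ^ ((c - 1) * (-(a' * x)) + p ^ s * a') = 1 := by
    rw [hη.zpow_eq_one_iff_dvd]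
    push_cast
    rw [hu, hr]
    exact ⟨a' * y, by linear_combination (p : ℤ) ^ s * a' * (-hxy)⟩
  rw [map_mul, map_zpow₀, hσ, hβ, ← mul_assoc, ← zpow_mul, ← zpow_add₀ hη0]
  congr 1
  rw [show c * -(a' * x) + p ^ s * a' = ((c - 1) * (-(a' * x)) + p ^ s * a') + (-(a' * x)) by ring,
    zpow_add₀ hη0, h1, one_mul]

/-- If `τ γ = η ^ b * γ`, commuting `τ` with `σ` shows that `σ` fixes `η ^ b`. This forces `p ^ (r -
s) ∣ b`, so the factor dies in the `p ^ s`-th power. -/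
theorem pow_mem_range_of_map_eq [FiniteDimensional K L] [IsAbelianGalois K L] (hp : p.Prime)
    (hη : IsPrimitiveRoot η (p ^ r)) (hs : emultiplicity (p : ℤ) (c - 1) = s) (hsr : s ≤ r)
    (σ : Gal(L/K)) (hσ : σ η = η ^ c) {γ : L} (hγ0 : γ ≠ 0) (hγ : σ γ = γ) {α : K}
    (hα : γ ^ p ^ r = algebraMap K L α) : ∃ g : K, algebraMap K L g = γ ^ p ^ s := by
  have hη0 : η ≠ 0 := hη.ne_zero (pow_ne_zero _ hp.ne_zero)
  have : NeZero (p ^ r) := ⟨pow_ne_zero _ hp.ne_zero⟩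
  obtain ⟨⟨u, hu⟩, hn⟩ := emultiplicity_eq_coe.mp hs
  have hpu : ¬ (p : ℤ) ∣ u := fun ⟨w, hw⟩ => hn ⟨w, by rw [hu, hw]; ring⟩
  have hr : (p : ℤ) ^ r = p ^ s * p ^ (r - s) := by rw [← pow_add, Nat.add_sub_cancel' hsr]
  rw [← Set.mem_range, IsGalois.mem_range_algebraMap_iff_fixed]
  intro τ
  obtain ⟨b, -, hb⟩ := hη.eq_pow_of_pow_eq_one (ξ := τ γ / γ) (by
    rw [div_pow, ← map_pow, hα, AlgEquiv.commutes, ← hα, div_self (pow_ne_zero _ hγ0)])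
  have hτ : τ γ = η ^ b * γ := by rw [hb, div_mul_cancel₀ _ hγ0]
  have hcomm : σ (τ γ) = τ (σ γ) := by
    have := mul_comm' σ τ
    exact DFunLike.congr_fun this γ
  rw [hγ, hτ, map_mul, map_pow, hσ, hγ] at hcomm
  have h1 : η ^ ((c - 1) * b) = 1 := by
    have h2 := mul_right_cancel₀ hγ0 hcomm
    rw [sub_mul, one_mul, zpow_sub₀ hη0, zpow_mul, zpow_natCast, zpow_natCast, h2,
      div_self (pow_ne_zero _ hη0)]
  rw [hη.zpow_eq_one_iff_dvd] at h1
  push_cast at h1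
  rw [hu, hr, mul_assoc] at h1
  have h2 := (mul_dvd_mul_iff_left (pow_ne_zero s (Int.natCast_ne_zero.mpr hp.ne_zero))).mp h1
  have hcop : IsCoprime ((p : ℤ) ^ (r - s)) u :=
    (((Nat.prime_iff_prime_int.mp hp).irreducible.coprime_iff_not_dvd).mpr hpu).pow_left
  have h3 : p ^ (r - s) ∣ b := by exact_mod_cast hcop.dvd_of_dvd_mul_left h2
  obtain ⟨b', rfl⟩ := h3
  rw [map_pow, hτ, mul_pow, ← pow_mul, mul_right_comm, ← pow_add, Nat.sub_add_cancel hsr, pow_mul,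
    hη.pow_eq_one, one_pow, one_mul]

theorem iterate_map_eq_zpow_geom_sum_mul (σ : Gal(L/K)) (hη0 : η ≠ 0) (hσ : σ η = η ^ c)
    {β : L} {a : ℤ} (hβ : σ β = η ^ a * β) (n : ℕ) :
    (σ ^ n) η = η ^ c ^ n ∧ (σ ^ n) β = η ^ (a * ∑ i ∈ Finset.range n, c ^ i) * β := by
  induction n with
  | zero => simp
  | succ n ih =>
    rw [pow_succ', AlgEquiv.mul_apply, AlgEquiv.mul_apply, ih.1, ih.2, map_mul, map_zpow₀,
      map_zpow₀, hσ, hβ, ← zpow_mul, ← zpow_mul, ← mul_assoc, ← zpow_add₀ hη0]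
    refine ⟨by rw [pow_succ'], ?_⟩
    rw [Finset.sum_range_succ', pow_zero]
    simp only [pow_succ, ← Finset.sum_mul]
    congr 2
    ring

/-- An automorphism that is non-trivial on the `p`-power roots of unity, but trivial on those of
order prime to `p`, forces `p`-power Kummer radicals inside a cyclotomic extension of `K` down
to `K`, up to a bounded loss. -/
theorem exists_pow_eq_of_cyclotomic {m : ℕ} [NeZero (p ^ r * m)]
    [IsCyclotomicExtension {p ^ r * m} K L] (hp : p.Prime) (hpm : ¬ p ∣ m) {ζ : L}
    (hζ : IsPrimitiveRoot ζ (p ^ r * m)) (σ : Gal(L/K)) (hσm : σ (ζ ^ p ^ r) = ζ ^ p ^ r)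
    (hσ : σ (ζ ^ m) = (ζ ^ m) ^ c) (hs : emultiplicity (p : ℤ) (c - 1) = s) (hsr : s ≤ r)
    (hs2 : p = 2 → 2 ≤ s) {α : K} {β : L} (hβ0 : β ≠ 0) (hβ : β ^ p ^ r = algebraMap K L α) :
    ∃ g : K, g ^ p ^ (r - s) = α := by
  have hm0 : p ^ r * m ≠ 0 := NeZero.ne _
  have hη : IsPrimitiveRoot (ζ ^ m) (p ^ r) := hζ.pow hm0.bot_lt (mul_comm _ _)
  have : NeZero (p ^ r) := ⟨pow_ne_zero _ hp.ne_zero⟩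
  have : FiniteDimensional K L := IsCyclotomicExtension.finiteDimensional {p ^ r * m} K L
  have : IsAbelianGalois K L := IsCyclotomicExtension.isAbelianGalois {p ^ r * m} K L
  have hη0 : ζ ^ m ≠ 0 := hη.ne_zero (NeZero.ne _)
  obtain ⟨a, -, ha⟩ := hη.eq_pow_of_pow_eq_one (ξ := σ β / β) (by
    rw [div_pow, ← map_pow, hβ, AlgEquiv.commutes, ← hβ, div_self (pow_ne_zero _ hβ0)])
  have hσβ : σ β = (ζ ^ m) ^ (a : ℤ) * β := by
    rw [zpow_natCast, ha, div_mul_cancel₀ _ hβ0]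
  have hpa : (p : ℤ) ^ s ∣ a := by
    rcases Nat.eq_zero_or_pos s with rfl | hs1
    · simp
    have hiter := iterate_map_eq_zpow_geom_sum_mul σ hη0 hσ hσβ (p ^ (r - s))
    -- By lifting the exponent this power fixes `η = ζ ^ m`; it also fixes `ζ ^ p ^ r`, and the two
    -- generate `ζ`.
    have hfix : σ ^ p ^ (r - s) = 1 := by
      have hfm : (σ ^ p ^ (r - s)) (ζ ^ p ^ r) = ζ ^ p ^ r := by
        generalize p ^ (r - s) = n
        induction n with
        | zero => simp
        | succ n ih => rw [pow_succ', AlgEquiv.mul_apply, ih, hσm]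
      have hfη : (σ ^ p ^ (r - s)) (ζ ^ m) = ζ ^ m := by
        rw [hiter.1]
        have hdvd : (p : ℤ) ^ r ∣ c ^ p ^ (r - s) - 1 := by
          apply pow_dvd_of_le_emultiplicity
          rw [emultiplicity_pow_prime_pow_sub_one hp hs hs1 hs2]
          exact_mod_cast (Nat.add_sub_cancel' hsr).ge
        have h1 : (ζ ^ m) ^ (c ^ p ^ (r - s) - 1) = 1 := by
          rw [hη.zpow_eq_one_iff_dvd]
          exact_mod_cast hdvd
        rw [zpow_sub₀ hη0, zpow_one, div_eq_one_iff_eq hη0] at h1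
        exact h1
      have hfζ : (σ ^ p ^ (r - s)) ζ = ζ := by
        have hζ0 : ζ ≠ 0 := hζ.ne_zero hm0
        have hcop : IsCoprime ((p ^ r : ℕ) : ℤ) (m : ℤ) :=
          (((Nat.Prime.coprime_iff_not_dvd hp).mpr hpm).pow_left r).isCoprime
        obtain ⟨x, y, hxy⟩ := hcop
        have : ζ = (ζ ^ p ^ r) ^ x * (ζ ^ m) ^ y := by
          rw [← zpow_natCast, ← zpow_natCast, ← zpow_mul, ← zpow_mul, ← zpow_add₀ hζ0,
            mul_comm _ x, mul_comm _ y, hxy, zpow_one]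
        conv_lhs => rw [this, map_mul, map_zpow₀, map_zpow₀, hfm, hfη]
        exact this.symm
      have : (σ ^ p ^ (r - s) : L ≃ₐ[K] L).toAlgHom = AlgHom.id K L :=
        (hζ.powerBasis K).algHom_ext (by simpa using hfζ)
      ext x
      exact DFunLike.congr_fun this x
    refine prime_pow_dvd_of_dvd_mul_geom_sum hp hs hs1 hs2 (j := r - s) ?_
    rw [Nat.add_sub_cancel' hsr]
    have h1 := hiter.2
    rw [hfix, AlgEquiv.one_apply] at h1
    have h2 := (mul_eq_right₀ hβ0).mp h1.symm
    rw [hη.zpow_eq_one_iff_dvd] at h2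
    exact_mod_cast h2
  obtain ⟨t, ht⟩ := exists_map_zpow_mul_eq hp hη hs hsr σ hσ hσβ hpa
  have hγ : ((ζ ^ m) ^ t * β) ^ p ^ r = algebraMap K L α := by
    rw [mul_pow, hβ, ← zpow_natCast, zpow_comm, zpow_natCast, hη.pow_eq_one, one_zpow, one_mul]
  obtain ⟨g, hg⟩ := pow_mem_range_of_map_eq hp hη hs hsr σ hσ
    (mul_ne_zero (zpow_ne_zero _ hη0) hβ0) ht hγ
  refine ⟨g, (algebraMap K L).injective ?_⟩
  rw [map_pow, hg, ← pow_mul, ← pow_add, Nat.add_sub_cancel' hsr, hγ]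

end Kummer

theorem exists_pow_eq_of_prime_pow {K : Type*} [Field K] {α : K} (hα : α ≠ 0) {n : ℕ} (hn : 0 < n)
    (h : ∀ p k : ℕ, p.Prime → p ^ k ∣ n → ∃ g : K, g ^ p ^ k = α) : ∃ g : K, g ^ n = α := by
  induction n using Nat.recOnPosPrimePosCoprime with
  | prime_pow p k hp hk => exact h p k hp dvd_rfl
  | zero => omega
  | one => exact ⟨α, pow_one α⟩
  | coprime a b ha hb hab iha ihb =>
    obtain ⟨x, hx⟩ := iha (by omega) fun p k hp hpk => h p k hp (hpk.mul_right b)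
    obtain ⟨y, hy⟩ := ihb (by omega) fun p k hp hpk => h p k hp (hpk.mul_left a)
    obtain ⟨u, v, huv⟩ := Nat.Coprime.isCoprime hab
    -- With `u * a + v * b = 1`, the `a * b`-th power is `α ^ (u * a) * α ^ (v * b) = α`.
    refine ⟨y ^ u * x ^ v, ?_⟩
    rw [mul_pow, mul_comm a b, pow_mul, ← zpow_natCast (y ^ u) b, zpow_comm, zpow_natCast, hy,
      mul_comm b a, pow_mul, ← zpow_natCast (x ^ v) a, zpow_comm, zpow_natCast, hx,
      ← zpow_natCast, ← zpow_natCast, ← zpow_mul, ← zpow_mul, ← zpow_add₀ hα, huv, zpow_one]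

end ChevalleyBass

namespace ChevalleyBass

/-! ### Ramification in cyclotomic extensions. -/

section Ramification

/-- The different contains `f'(z)` for `f` the minimal polynomial of `z = ζ_m`, and `f'(z)` divides
`m * z ^ (m - 1)`, which lies outside `P`. -/
theorem isUnramifiedAt_of_isCyclotomicExtension {M N : Type*} [Field M] [NumberField M]
    [Field N] [NumberField N] [Algebra M N] {m : ℕ} [NeZero m] [IsCyclotomicExtension {m} M N]
    (P : Ideal (𝓞 N)) [P.IsPrime] (hP : (m : 𝓞 N) ∉ P) :
    Algebra.IsUnramifiedAt (𝓞 M) P := by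
  rw [← not_dvd_differentIdeal_iff, Ideal.dvd_iff_le]
  intro hle
  have hζ := IsCyclotomicExtension.zeta_spec m M N
  set z : 𝓞 N := hζ.toInteger with hz
  have hzp : z ^ m = 1 := hζ.toInteger_isPrimitiveRoot.pow_eq_one
  have hmem := hle (aeval_derivative_mem_differentIdeal (𝓞 M) M N z
    (IsCyclotomicExtension.adjoin_primitive_root_eq_top hζ))
  obtain ⟨q, hq⟩ : minpoly (𝓞 M) z ∣ (Polynomial.X ^ m - 1) :=
    minpoly.isIntegrallyClosed_dvd (Algebra.IsIntegral.isIntegral z) (by simp [hzp])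
  have h1 := congrArg (fun f => Polynomial.aeval z (Polynomial.derivative f)) hq
  simp only [Polynomial.derivative_mul, Polynomial.derivative_X_pow, Polynomial.derivative_one,
    map_add, map_mul, map_sub, sub_zero, map_pow,
    Polynomial.aeval_X, minpoly.aeval, zero_mul, add_zero, map_natCast] at h1
  have h2 : (m : 𝓞 N) * z ^ (m - 1) ∈ P := by
    rw [h1]
    exact P.mul_mem_right _ hmem
  refine hP ?_
  have h3 := P.mul_mem_right z h2
  rwa [mul_assoc, ← pow_succ, Nat.sub_add_cancel (NeZero.pos m), hzp, mul_one] at h3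

/-- If an extension generated by roots of unity of order prime to `p` contains the
`p ^ (k + 1)`-th roots of unity, then these are already seen by the ramification at `p` of the
base field. -/
theorem dvd_ramificationIdx_of_isPrimitiveRoot {M N : Type*} [Field M] [NumberField M]
    [Field N] [NumberField N] [Algebra M N] {m p k : ℕ} [NeZero m] [IsCyclotomicExtension {m} M N]
    (hp : p.Prime) (hpm : ¬ p ∣ m) {ξ : N} (hξ : IsPrimitiveRoot ξ (p ^ (k + 1)))
    (P : Ideal (𝓞 M)) [P.IsPrime] [P.LiesOver (Ideal.span {(p : ℤ)})] :
    p ^ k * (p - 1) ∣ P.ramificationIdx ℤ := by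
  have : Fact p.Prime := ⟨hp⟩
  have : NeZero (p ^ (k + 1)) := ⟨pow_ne_zero _ hp.ne_zero⟩
  obtain ⟨⟨Q, hQ, hQP⟩⟩ := P.nonempty_primesOver (S := 𝓞 N)
  have : Q.LiesOver (Ideal.span {(p : ℤ)}) := Ideal.LiesOver.trans Q P _
  have hmQ : (m : 𝓞 N) ∉ Q := fun h => by
    have h1 : (m : ℤ) ∈ Ideal.span {(p : ℤ)} := by
      rw [Q.over_def (Ideal.span {(p : ℤ)})]
      simpa using h
    rw [Ideal.mem_span_singleton] at h1
    exact hpm (by exact_mod_cast h1)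
  have := isUnramifiedAt_of_isCyclotomicExtension (M := M) (m := m) Q hmQ
  have h1 : Q.ramificationIdx ℤ = P.ramificationIdx ℤ := by
    rw [Ideal.ramificationIdx_tower (R := ℤ) P Q, Ideal.ramificationIdx_eq_one Q (𝓞 M), mul_one]
  let F := IntermediateField.adjoin ℚ {ξ}
  have : IsCyclotomicExtension {p ^ (k + 1)} ℚ F :=
    hξ.intermediateField_adjoin_isCyclotomicExtension ℚ
  have : (Q.under (𝓞 F)).LiesOver (Ideal.span {(p : ℤ)}) := Ideal.LiesOver.tower_bot Q _ _
  -- Total ramification of `p` in `ℚ(ξ)` gives index `p ^ k * (p - 1)`, which divides the index of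
  -- `Q`.
  rw [← h1, ← IsCyclotomicExtension.Rat.ramificationIdx_eq_of_prime_pow p k F (Q.under (𝓞 F))]
  exact Ideal.ramificationIdx_below_dvd (Q.under (𝓞 F)) Q

end Ramification

/-! ### The invariants `ε_p`, `ε₂` and the roots of unity they exclude. -/

section Epsilon

variable (K : Type*) [Field K] [NumberField K]

theorem liesOver_of_mem_primesOverFinset {p : ℕ} (hp : p.Prime) {P : Ideal (𝓞 K)} :
    P ∈ IsDedekindDomain.primesOverFinset (Ideal.span {(p : ℤ)}) (𝓞 K) ↔
      P.IsPrime ∧ P.LiesOver (Ideal.span {(p : ℤ)}) := by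
  have : Fact p.Prime := ⟨hp⟩
  exact IsDedekindDomain.mem_primesOverFinset_iff (by simpa using hp.ne_zero) _

theorem exists_mem_primesOverFinset {p : ℕ} (hp : p.Prime) :
    ∃ P, P ∈ IsDedekindDomain.primesOverFinset (Ideal.span {(p : ℤ)}) (𝓞 K) := by
  have : Fact p.Prime := ⟨hp⟩
  obtain ⟨⟨P, hP⟩⟩ := (Ideal.span {(p : ℤ)}).nonempty_primesOver (S := 𝓞 K)
  exact ⟨P, (liesOver_of_mem_primesOverFinset K hp).mpr hP⟩

theorem ramificationIdx_le_finrank (P : Ideal (𝓞 K)) {p : ℕ} (hp : p.Prime) [hP : P.IsPrime]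
    [hP' : P.LiesOver (Ideal.span {(p : ℤ)})] : P.ramificationIdx ℤ ≤ Module.finrank ℤ (𝓞 K) := by
  have : Fact p.Prime := ⟨hp⟩
  rw [← Ideal.sum_ramification_inertia_eq_finrank (Ideal.span {(p : ℤ)})]
  refine le_trans ?_ (Finset.single_le_sum (fun _ _ => Nat.zero_le _)
    (Finset.mem_univ (⟨P, hP, hP'⟩ : (Ideal.span {(p : ℤ)}).primesOver (𝓞 K))))
  exact Nat.le_mul_of_pos_right _ (P.inertiaDeg_pos ℤ)

theorem epsilon_ne_zero {p : ℕ} (hp : p.Prime) : epsilon K p ≠ 0 := by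
  obtain ⟨P, hP⟩ := exists_mem_primesOverFinset K hp
  have := ((liesOver_of_mem_primesOverFinset K hp).mp hP).1
  exact fun h => (P.ramificationIdx_pos ℤ).ne' (Finset.gcd_eq_zero_iff.mp h P hP)

theorem epsilon_le_finrank {p : ℕ} (hp : p.Prime) : epsilon K p ≤ Module.finrank ℤ (𝓞 K) := by
  obtain ⟨P, hP⟩ := exists_mem_primesOverFinset K hp
  obtain ⟨h1, h2⟩ := (liesOver_of_mem_primesOverFinset K hp).mp hP
  exact (Nat.le_of_dvd (P.ramificationIdx_pos ℤ)
    (Finset.gcd_dvd (f := fun 𝔭 : Ideal (𝓞 K) => 𝔭.ramificationIdx ℤ) hP)).trans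
    (ramificationIdx_le_finrank K P hp)

/-- Ramification indices are at most `[K : ℚ]`, so a distinguished `p` is at most `[K : ℚ] + 1`. -/
theorem finite_setOf_distinguished : {p : ℕ | Distinguished K p}.Finite := by
  refine (Set.finite_Iic (Module.finrank ℤ (𝓞 K) + 1)).subset fun p hp => ?_
  have h1 := Nat.le_of_dvd (epsilon_ne_zero K hp.1).bot_lt hp.2.2
  have h2 := epsilon_le_finrank K hp.1
  simp only [Set.mem_Iic]
  omega

theorem prime_one_add_i : Prime (⟨1, 1⟩ : GaussianInt) := by
  rw [← irreducible_iff_prime]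
  refine ⟨fun h => ?_, fun a b hab => ?_⟩
  · have := Zsqrtd.norm_eq_one_iff.mpr h
    simp [Zsqrtd.norm] at this
  · have h := congrArg (fun x => (Zsqrtd.norm x).natAbs) hab
    simp only [Zsqrtd.norm_mul, Int.natAbs_mul] at h
    have h2 : (Zsqrtd.norm (⟨1, 1⟩ : GaussianInt)).natAbs = 2 := by simp [Zsqrtd.norm]
    rw [h2] at h
    rw [← Zsqrtd.norm_eq_one_iff, ← Zsqrtd.norm_eq_one_iff]
    rcases (Nat.dvd_prime Nat.prime_two).mp ⟨_, h⟩ with h1 | h1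
    · exact Or.inl h1
    · rw [h1] at h
      omega

theorem span_one_add_i_ne_bot : Ideal.span {(⟨1, 1⟩ : GaussianInt)} ≠ ⊥ := by
  simpa using prime_one_add_i.ne_zero

instance isPrime_span_one_add_i : (Ideal.span {(⟨1, 1⟩ : GaussianInt)}).IsPrime :=
  (Ideal.span_singleton_prime prime_one_add_i.ne_zero).mpr prime_one_add_i

instance isMaximal_span_one_add_i : (Ideal.span {(⟨1, 1⟩ : GaussianInt)}).IsMaximal :=
  isPrime_span_one_add_i.isMaximal span_one_add_i_ne_bot

theorem map_span_two : (Ideal.span {((2 : ℕ) : ℤ)}).map (algebraMap ℤ GaussianInt) =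
    Ideal.span {(⟨1, 1⟩ : GaussianInt)} ^ 2 := by
  rw [Ideal.map_span, Set.image_singleton, Ideal.span_singleton_pow,
    Ideal.span_singleton_eq_span_singleton]
  -- The unit is `i`: `(1 + i) ^ 2 = 2 * i`.
  exact ⟨⟨⟨0, 1⟩, ⟨0, -1⟩, by decide, by decide⟩, by decide⟩

instance liesOver_span_one_add_i :
    (Ideal.span {(⟨1, 1⟩ : GaussianInt)}).LiesOver (Ideal.span {((2 : ℕ) : ℤ)}) := by
  have : Fact (Nat.Prime 2) := ⟨Nat.prime_two⟩
  rw [Ideal.liesOver_iff]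
  refine Ideal.IsMaximal.eq_of_le (Int.ideal_span_isMaximal_of_prime 2) Ideal.IsPrime.ne_top' ?_
  rw [← Ideal.map_le_iff_le_comap, map_span_two]
  exact Ideal.pow_le_self two_ne_zero

theorem ramificationIdx_span_one_add_i :
    (Ideal.span {(⟨1, 1⟩ : GaussianInt)}).ramificationIdx ℤ = 2 := by
  have h := map_span_two
  rw [Ideal.IsDedekindDomain.ramificationIdx_eq_multiplicity (Ideal.span {((2 : ℕ) : ℤ)}), h,
    multiplicity_pow_self span_one_add_i_ne_bot
      (Ideal.isUnit_iff.not.mpr isPrime_span_one_add_i.ne_top)]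
  rw [h]
  exact pow_ne_zero 2 span_one_add_i_ne_bot

theorem algebraMap_gaussianInt_injective :
    Function.Injective (algebraMap GaussianInt (𝓞 (AdjoinI K))) :=
  Zsqrtd.lift_injective _ fun n => by nlinarith [mul_self_nonneg n]

instance isTorsionFree_gaussianInt : Module.IsTorsionFree GaussianInt (𝓞 (AdjoinI K)) :=
  Module.isTorsionFree_iff_algebraMap_injective.mpr (algebraMap_gaussianInt_injective K)

instance finite_gaussianInt : Module.Finite GaussianInt (𝓞 (AdjoinI K)) :=
  Module.Finite.of_restrictScalars_finite ℤ _ _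

theorem mem_primesOverFinset_span_one_add_i {P : Ideal (𝓞 (AdjoinI K))} :
    P ∈ IsDedekindDomain.primesOverFinset (Ideal.span {(⟨1, 1⟩ : GaussianInt)})
      (𝓞 (AdjoinI K)) ↔ P.IsPrime ∧ P.LiesOver (Ideal.span {(⟨1, 1⟩ : GaussianInt)}) :=
  IsDedekindDomain.mem_primesOverFinset_iff span_one_add_i_ne_bot _

theorem epsilonTwo_ne_zero : epsilonTwo K ≠ 0 := by
  obtain ⟨⟨P, hP⟩⟩ :=
    (Ideal.span {(⟨1, 1⟩ : GaussianInt)}).nonempty_primesOver (S := 𝓞 (AdjoinI K))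
  have := hP.1
  exact fun h => (P.ramificationIdx_pos GaussianInt).ne'
    (Finset.gcd_eq_zero_iff.mp h P ((mem_primesOverFinset_span_one_add_i K).mpr hP))

theorem not_isPrimitiveRoot_of_odd {N : Type*} [Field N] [NumberField N] [Algebra K N] {m p : ℕ}
    [NeZero m] [IsCyclotomicExtension {m} K N] (hp : p.Prime) (hp2 : p ≠ 2) (hpm : ¬ p ∣ m)
    (ξ : N) : ¬ IsPrimitiveRoot ξ (p ^ (lam K p + 1)) := by
  intro hξ
  have hdvd : p ^ lam K p * (p - 1) ∣ epsilon K p := by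
    refine Finset.dvd_gcd fun P hP => ?_
    obtain ⟨_, _⟩ := (liesOver_of_mem_primesOverFinset K hp).mp hP
    exact dvd_ramificationIdx_of_isPrimitiveRoot hp hpm hξ P
  have hd : Distinguished K p :=
    ⟨hp, by have := hp.two_le; omega, (dvd_mul_left _ _).trans hdvd⟩
  have : Fact p.Prime := ⟨hp⟩
  have h1 := (padicValNat_dvd_iff_le (epsilon_ne_zero K hp)).mp ((dvd_mul_right _ _).trans hdvd)
  rw [lam, if_neg hp2, if_pos hd] at h1
  omega

theorem not_isPrimitiveRoot_two {N : Type*} [Field N] [NumberField N] [Algebra (AdjoinI K) N]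
    {m : ℕ} [NeZero m] [IsCyclotomicExtension {m} (AdjoinI K) N] (hpm : ¬ 2 ∣ m) (ξ : N) :
    ¬ IsPrimitiveRoot ξ (2 ^ (lam K 2 + 1)) := by
  intro hξ
  have hdvd : 2 ^ (lam K 2 - 1) ∣ epsilonTwo K := by
    refine Finset.dvd_gcd fun P hP => ?_
    obtain ⟨_, _⟩ := (mem_primesOverFinset_span_one_add_i K).mp hP
    have : P.LiesOver (Ideal.span {((2 : ℕ) : ℤ)}) :=
      Ideal.LiesOver.trans P (Ideal.span {(⟨1, 1⟩ : GaussianInt)}) _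
    have h := dvd_ramificationIdx_of_isPrimitiveRoot Nat.prime_two hpm hξ P
    -- Since `e(P/2) = 2 * e(P/(1 + i))`, one factor `2` is lost in passing to `ε₂`; the `+ 3` in
    -- `lam` more than covers it.
    rw [Ideal.ramificationIdx_tower (R := ℤ) (Ideal.span {(⟨1, 1⟩ : GaussianInt)}) P,
      ramificationIdx_span_one_add_i, Nat.add_one_sub_one, mul_one] at h
    have h1 : lam K 2 = lam K 2 - 1 + 1 := by rw [lam, if_pos rfl]; omega
    rw [h1, pow_succ', Nat.mul_dvd_mul_iff_left two_pos] at h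
    exact h
  have : Fact (Nat.Prime 2) := ⟨Nat.prime_two⟩
  have h1 := (padicValNat_dvd_iff_le (epsilonTwo_ne_zero K)).mp hdvd
  rw [lam, if_pos rfl] at h1
  omega

end Epsilon

end ChevalleyBass

namespace ChevalleyBass

/-! ### Choice of `σ` and the prime power case. -/

theorem exists_prime_pow_eq {K M L : Type*} [Field K] [Field M] [Field L] [Algebra K M]
    [Algebra K L] [Algebra M L] [IsScalarTower K M L] {p r m l k : ℕ} [NeZero (p ^ r * m)]
    [IsCyclotomicExtension {p ^ r * m} K L] (hp : p.Prime) (hpm : ¬ p ∣ m) {ζ : L}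
    (hζ : IsPrimitiveRoot ζ (p ^ r * m))
    (hM : ∀ ξ : IntermediateField.adjoin M {ζ ^ p ^ r}, ¬ IsPrimitiveRoot ξ (p ^ (l + 1)))
    (hi : p = 2 → 2 ≤ l ∧ ∃ i : M, IsPrimitiveRoot i 4) (hk : 1 ≤ k) (hlk : l + k ≤ r)
    {α : K} {β : L} (hβ0 : β ≠ 0) (hβ : β ^ p ^ r = algebraMap K L α) :
    ∃ g : K, g ^ p ^ k = α := by
  have hm0 : p ^ r * m ≠ 0 := NeZero.ne _
  have : NeZero (p ^ r) := ⟨pow_ne_zero _ hp.ne_zero⟩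
  have : FiniteDimensional K L := IsCyclotomicExtension.finiteDimensional {p ^ r * m} K L
  have : IsGalois K L := IsCyclotomicExtension.isGalois {p ^ r * m} K L
  have : FiniteDimensional M L := FiniteDimensional.right K M L
  have : IsGalois M L := IsGalois.tower_top_of_isGalois K M L
  have hη : IsPrimitiveRoot (ζ ^ m) (p ^ r) := hζ.pow hm0.bot_lt (mul_comm _ _)
  have hη0 : ζ ^ m ≠ 0 := hη.ne_zero (NeZero.ne _)
  have hξ : IsPrimitiveRoot ((ζ ^ m) ^ p ^ (r - (l + 1))) (p ^ (l + 1)) :=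
    hη.pow (pow_pos hp.pos _) (by rw [← pow_add]; congr 1; omega)
  obtain ⟨σ, hσξ⟩ : ∃ σ : Gal(L/(IntermediateField.adjoin M {ζ ^ p ^ r})),
      σ ((ζ ^ m) ^ p ^ (r - (l + 1))) ≠ (ζ ^ m) ^ p ^ (r - (l + 1)) := by
    by_contra! h
    obtain ⟨x, hx⟩ := (IsGalois.mem_range_algebraMap_iff_fixed _).mpr h
    rw [← hx] at hξ
    exact hM x (hξ.of_map_of_injective (FaithfulSMul.algebraMap_injective _ L))
  obtain ⟨c, -, hc⟩ := hη.eq_pow_of_pow_eq_one (ξ := σ (ζ ^ m)) (by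
    rw [← map_pow, hη.pow_eq_one, map_one])
  have hσz : ∀ x : L, x ^ p ^ r = 1 → σ x = x ^ (c : ℤ) := fun x hx => by
    obtain ⟨b, -, rfl⟩ := hη.eq_pow_of_pow_eq_one hx
    rw [map_pow, ← hc, zpow_natCast, pow_right_comm]
  have hfix : ∀ (x : L) (d : ℕ), IsPrimitiveRoot x d → d ≠ 0 → x ^ p ^ r = 1 →
      (σ x = x ↔ (d : ℤ) ∣ (c : ℤ) - 1) := fun x d hx hd hx1 => by
    have hx0 : x ≠ 0 := hx.ne_zero hd
    rw [hσz x hx1, ← hx.zpow_eq_one_iff_dvd, zpow_sub₀ hx0, zpow_one, div_eq_one_iff_eq hx0]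
  have hndvd : ¬ (p : ℤ) ^ (l + 1) ∣ (c : ℤ) - 1 := fun h => by
    refine hσξ ((hfix _ _ hξ (pow_ne_zero _ hp.ne_zero) ?_).mpr (by exact_mod_cast h))
    rw [← pow_mul, mul_comm, pow_mul, hη.pow_eq_one, one_pow]
  have hlt := emultiplicity_lt_iff_not_dvd.mpr hndvd
  obtain ⟨s, hs⟩ := ENat.ne_top_iff_exists.mp hlt.ne_top
  have hsl : s ≤ l := by
    rw [← hs] at hlt
    exact Nat.lt_succ_iff.mp (by exact_mod_cast hlt)
  -- This is why `K(i)` replaces `K` at `2`: `σ` fixes `i`, so `c ≡ 1` modulo `4`, as lifting the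
  -- exponent at `2` requires.
  have hs2 : p = 2 → 2 ≤ s := by
    rintro rfl
    obtain ⟨hl, i, hi⟩ := hi rfl
    have hi' : IsPrimitiveRoot (algebraMap M L i) 4 :=
      hi.map_of_injective (algebraMap M L).injective
    have h4 : ((4 : ℕ) : ℤ) ∣ (c : ℤ) - 1 := by
      refine (hfix _ 4 hi' (by norm_num) ((hi'.pow_eq_one_iff_dvd _).mpr ?_)).mp ?_
      · exact pow_dvd_pow 2 (by omega : 2 ≤ r)
      · rw [IsScalarTower.algebraMap_apply M (IntermediateField.adjoin M {ζ ^ 2 ^ r}) L,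
          AlgEquiv.commutes]
    have : ((2 : ℕ) : ℕ∞) ≤ s := hs ▸ le_emultiplicity_of_pow_dvd (by exact_mod_cast h4)
    exact_mod_cast this
  obtain ⟨g, hg⟩ := exists_pow_eq_of_cyclotomic (c := c) hp hpm hζ
    ((σ.restrictScalars M).restrictScalars K)
    (by
      have hmem := IntermediateField.mem_adjoin_simple_self M (ζ ^ p ^ r)
      exact σ.commutes ⟨_, hmem⟩)
    (hσz _ hη.pow_eq_one) hs.symm (by omega) hs2 hβ0 hβ
  refine ⟨g ^ p ^ (r - s - k), ?_⟩
  rw [← pow_mul, ← pow_add, ← hg]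
  congr 2
  omega

/-! ### The constant `Λ` and its prime power divisors. -/

section BassConstant

variable (K : Type*) [Field K] [NumberField K]

/-- Without finite support, `finprod` would take the default value `1`. -/
theorem finite_mulSupport_pow_lam :
    (Function.mulSupport fun p : ℕ => ∏ᶠ _ : p.Prime ∧ 3 ≤ p, p ^ lam K p).Finite := by
  refine (finite_setOf_distinguished K).subset fun p hp => ?_
  by_contra (hd : ¬ Distinguished K p)
  refine hp ((finprod_congr fun h => ?_).trans finprod_one)
  rw [lam, if_neg (by omega), if_neg hd, pow_zero]

theorem bassConstant_pos : 0 < bassConstant K := by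
  refine Nat.mul_pos (by positivity) ?_
  refine finprod_induction (0 < ·) one_pos (fun _ _ => Nat.mul_pos) fun p => ?_
  exact finprod_induction (0 < ·) one_pos (fun _ _ => Nat.mul_pos) fun h => pow_pos h.1.pos _

theorem pow_lam_dvd_bassConstant {p : ℕ} (hp : p.Prime) : p ^ lam K p ∣ bassConstant K := by
  rcases eq_or_ne p 2 with rfl | hp2
  -- Only `2 ^ λ₂` of the factor `4 ^ λ₂` is needed.
  · exact (pow_dvd_pow_of_dvd (by norm_num) _).trans (dvd_mul_right _ _)
  · have h : p.Prime ∧ 3 ≤ p := ⟨hp, by have := hp.two_le; omega⟩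
    refine Dvd.dvd.mul_left ?_ _
    have := finprod_mem_dvd (f := fun p : ℕ => ∏ᶠ _ : p.Prime ∧ 3 ≤ p, p ^ lam K p) p
      (finite_mulSupport_pow_lam K)
    rwa [finprod_eq_if, if_pos h] at this

theorem exists_prime_pow_eq_of_cyclotomic {L : Type*} [Field L] [Algebra K L] {p r m k : ℕ}
    [NeZero (p ^ r * m)] [IsCyclotomicExtension {p ^ r * m} K L] (hp : p.Prime) (hpm : ¬ p ∣ m)
    (hk : 1 ≤ k) (hlk : lam K p + k ≤ r) {α : K} {β : L} (hβ0 : β ≠ 0)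
    (hβ : β ^ p ^ r = algebraMap K L α) : ∃ g : K, g ^ p ^ k = α := by
  have hm0 : p ^ r * m ≠ 0 := NeZero.ne _
  have hζ := IsCyclotomicExtension.zeta_spec (p ^ r * m) K L
  set ζ := IsCyclotomicExtension.zeta (p ^ r * m) K L
  have : NeZero m := ⟨right_ne_zero_of_mul hm0⟩
  have hζm : IsPrimitiveRoot (ζ ^ p ^ r) m := hζ.pow hm0.bot_lt rfl
  have : FiniteDimensional K L := IsCyclotomicExtension.finiteDimensional {p ^ r * m} K L
  rcases eq_or_ne p 2 with rfl | hp2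
  · have h3 : 3 ≤ lam K 2 := by rw [lam, if_pos rfl]; omega
    have h4 : ∃ ξ : L, IsPrimitiveRoot ξ 4 := by
      refine ⟨ζ ^ (2 ^ (r - 2) * m), hζ.pow hm0.bot_lt ?_⟩
      rw [mul_right_comm, show 4 = 2 ^ 2 by rfl, ← pow_add]
      congr 2
      omega
    obtain ⟨e⟩ := IsCyclotomicExtension.nonempty_algEquiv_adjoin_of_exists_isPrimitiveRoot {4} K
      (AdjoinI K) L (fun n hn _ => by rw [Set.mem_singleton_iff.mp hn]; exact h4)
    -- As `4 ∣ 2 ^ r`, `L` contains a primitive fourth root of unity, so `K(i)` embeds in `L` over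
    -- `K`.
    let f : AdjoinI K →ₐ[K] L := (IntermediateField.val _).comp e.toAlgHom
    let _ : Algebra (AdjoinI K) L := f.toRingHom.toAlgebra
    have : IsScalarTower K (AdjoinI K) L := IsScalarTower.of_algebraMap_eq' f.comp_algebraMap.symm
    have : FiniteDimensional (AdjoinI K) L := FiniteDimensional.right K (AdjoinI K) L
    have : IsCyclotomicExtension {m} (AdjoinI K)
        (IntermediateField.adjoin (AdjoinI K) {ζ ^ 2 ^ r}) :=
      hζm.intermediateField_adjoin_isCyclotomicExtension (AdjoinI K)
    have : NumberField (IntermediateField.adjoin (AdjoinI K) {ζ ^ 2 ^ r}) :=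
      NumberField.of_module_finite (AdjoinI K) _
    exact exists_prime_pow_eq (M := AdjoinI K) hp hpm hζ (not_isPrimitiveRoot_two K hpm)
      (fun _ => ⟨by omega, _, IsCyclotomicExtension.zeta_spec 4 K (AdjoinI K)⟩) hk hlk hβ0 hβ
  · have : IsCyclotomicExtension {m} K (IntermediateField.adjoin K {ζ ^ p ^ r}) :=
      hζm.intermediateField_adjoin_isCyclotomicExtension K
    have : NumberField (IntermediateField.adjoin K {ζ ^ p ^ r}) :=
      NumberField.of_module_finite K _
    exact exists_prime_pow_eq (M := K) hp hpm hζ (not_isPrimitiveRoot_of_odd K hp hp2 hpm)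
      (fun h => absurd h hp2) hk hlk hβ0 hβ

end BassConstant

end ChevalleyBass

/-- The first conjunct says that all but finitely many factors of the product defining
`bassConstant K` are `1`, so that the product is the genuine one. -/
theorem theorem1p1 (K : Type*) [Field K] [NumberField K] :
    {p : ℕ | ChevalleyBass.Distinguished K p}.Finite ∧
    ∃ Λ : ℕ, 0 < Λ ∧ Λ = ChevalleyBass.bassConstant K ∧
      ∀ n : ℕ, 0 < n → ∀ α : K,
        (∃ β : CyclotomicField (Λ * n) K,
          β ^ (Λ * n) = algebraMap K (CyclotomicField (Λ * n) K) α) →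
        ∃ γ : K, γ ^ n = α := by
  refine ⟨ChevalleyBass.finite_setOf_distinguished K, _, ChevalleyBass.bassConstant_pos K, rfl,
    fun n hn α ⟨β, hβ⟩ => ?_⟩
  rcases eq_or_ne α 0 with rfl | hα
  · exact ⟨0, zero_pow hn.ne'⟩
  have hΛn : ChevalleyBass.bassConstant K * n ≠ 0 :=
    (Nat.mul_pos (ChevalleyBass.bassConstant_pos K) hn).ne'
  have hβ0 : β ≠ 0 := by
    rintro rfl
    rw [zero_pow hΛn, eq_comm, map_eq_zero] at hβ
    exact hα hβ
  refine ChevalleyBass.exists_pow_eq_of_prime_pow hα hn fun p k hp hpk => ?_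
  rcases Nat.eq_zero_or_pos k with rfl | hk
  · exact ⟨α, by simp⟩
  obtain ⟨r, m, hpm, hrm⟩ := Nat.exists_eq_pow_mul_and_not_dvd hΛn p hp.ne_one
  have hr : ChevalleyBass.lam K p + k ≤ r := by
    have h1 : p ^ (ChevalleyBass.lam K p + k) ∣ p ^ r * m := by
      rw [← hrm, pow_add]
      exact mul_dvd_mul (ChevalleyBass.pow_lam_dvd_bassConstant K hp) hpk
    have h2 := (((Nat.Prime.coprime_iff_not_dvd hp).mpr hpm).pow_left _).dvd_of_dvd_mul_right h1
    exact (Nat.pow_dvd_pow_iff_le_right hp.one_lt).mp h2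
  have : NeZero (ChevalleyBass.bassConstant K * n) := ⟨hΛn⟩
  have : NeZero (p ^ r * m) := ⟨hrm ▸ hΛn⟩
  have : IsCyclotomicExtension {p ^ r * m} K
      (CyclotomicField (ChevalleyBass.bassConstant K * n) K) := by
    rw [← hrm]
    infer_instance
  refine ChevalleyBass.exists_prime_pow_eq_of_cyclotomic K hp hpm hk hr
    (pow_ne_zero m hβ0) (?_ : (β ^ m) ^ p ^ r = _)
  rw [← hβ, ← pow_mul, mul_comm m, ← hrm]
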